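/- Let $(\mathrm{ST}_h)_{h\in\mathbf{Z}}$ be independent random variables on a probability space, each distributed according to the Sato–Tate measure $\frac{1}{\pi}\sqrt{1-(x/2)^2}\,dx$ on $[-2,2]$. For $t\in[0,1]$ let $$\mathrm{K}(t)=\lim_{m\to+\infty}\ \sum_{|h|<m}\frac{e^{2\pi i h t}-1}{2\pi i h}\,\mathrm{ST}_h,$$ where the term $h=0$ is interpreted as $t\,\mathrm{ST}_0$; almost surely, this limit exists for every $t\in[0,1]$ and $t\mapsto \mathrm{K}(t)$ is continuous on $[0,1]$. Let $\|\mathrm{K}\|_\infty=\sup_{t\in[0,1]}|\mathrm{K}(t)|$. There exists an absolute constant $c>0$ such that $$c^{-1}\exp(-\exp(cA))\ \leq\ \mathbf{P}\bigl(\|\mathrm{K}\|_\infty\geq A\bigr)\ \leq\ c\exp(-\exp(c^{-1}A))$$ for every $A>0$. -/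

import Mathlib

open MeasureTheory ProbabilityTheory Filter Topology

noncomputable section

namespace KloostermanPaths

/-- The Sato-Tate measure `(1 / π) * √(1 - (x / 2) ^ 2) dx` on `[-2, 2]`. -/
def satoTate : Measure ℝ :=
  (volume.restrict (Set.Icc (-2 : ℝ) 2)).withDensity
    (fun x => ENNReal.ofReal (1 / Real.pi * Real.sqrt (1 - (x / 2) ^ 2)))

/-- The Fourier coefficient `(exp (2 π i h t) - 1) / (2 π i h)`, which is read as `t` for `h = 0`. -/
def beta (h : ℤ) (t : ℝ) : ℂ :=
  if h = 0 then (t : ℂ)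
  else (Complex.exp (2 * Real.pi * Complex.I * h * t) - 1) / (2 * Real.pi * Complex.I * h)

/-- The symmetric partial sum of the random series, over the integers `h` with `|h| < m`. -/
def partialK {Ω : Type*} (ST : ℤ → Ω → ℝ) (m : ℕ) (ω : Ω) (t : ℝ) : ℂ :=
  ∑ h ∈ Finset.Ioo (-(m : ℤ)) (m : ℤ), beta h t * (ST h ω : ℂ)

/-- The random function `K`: the pointwise limit of the symmetric partial sums. -/
def limitK {Ω : Type*} (ST : ℤ → Ω → ℝ) (ω : Ω) (t : ℝ) : ℂ :=
  limUnder atTop (fun m : ℕ => partialK ST m ω t)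

/-- The supremum norm over `[0, 1]`, with values in `[0, ∞]`. -/
def supNorm (f : ℝ → ℂ) : ENNReal :=
  ⨆ t ∈ Set.Icc (0 : ℝ) 1, ‖f t‖ₑ

end KloostermanPaths

end

/-! Size at most 2 for `ST h` and `‖beta h t‖ ≤ 1 / (π |h|)` make the frequencies below `16 ^ N`
contribute `O(N)` deterministically, the growth of a harmonic sum (`norm_partialK_pow_le`). The
frequencies above are small except with probability `exp (-c 4 ^ N)`: the block `16 ^ n ≤ |h| < 16 ^
(n + 1)` has standard deviation about `4 ^ (-n)`, so by Hoeffding it rarely exceeds `2 ^ (-n)`, and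
since each `beta h` is 1-Lipschitz a finite grid controls all `t` (`measure_not_blocksSmall_le`).
With `N` proportional to `A` this is the upper bound; summability of `2 ^ (-n)` also gives
convergence and continuity.

For the lower bound, take `t = 1 / 2`. If `ST h` has the sign of `h` and modulus at least 1 for `0 <
|h| < 16 ^ N`, all imaginary parts add up and reach `N / 2` (`im_partialK_pow_half_ge`). This costs
a constant factor for each of about `2 * 16 ^ N` variables, hence a double exponential probability.
The high frequencies are independent of this event and small with probability at least one half, so
they cannot cancel the gain. -/

namespace KloostermanPaths

/-! ### Fourier coefficients -/

lemma norm_exp_mul_sub_one_le (h : ℤ) (x : ℝ) :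
    ‖Complex.exp (2 * Real.pi * Complex.I * h * x) - 1‖ ≤ 2 * Real.pi * |(h : ℝ)| * |x| := by
  have := Real.norm_exp_I_mul_ofReal_sub_one_le (x := 2 * Real.pi * h * x)
  have e : (2 * Real.pi * Complex.I * h * x : ℂ)
      = Complex.I * ((2 * Real.pi * h * x : ℝ) : ℂ) := by
    push_cast; ring
  rw [e]
  refine this.trans (le_of_eq ?_)
  rw [Real.norm_eq_abs, abs_mul, abs_mul, abs_of_pos Real.two_pi_pos]

lemma norm_exp_two_pi_I_mul (h : ℤ) (x : ℝ) :
    ‖Complex.exp (2 * Real.pi * Complex.I * h * x)‖ = 1 := by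
  have e : (2 * Real.pi * Complex.I * h * x : ℂ)
      = ((2 * Real.pi * h * x : ℝ) : ℂ) * Complex.I := by
    push_cast; ring
  rw [e, Complex.norm_exp_ofReal_mul_I]

lemma norm_two_pi_I_mul (h : ℤ) :
    ‖(2 * Real.pi * Complex.I * h : ℂ)‖ = 2 * Real.pi * |(h : ℝ)| := by
  simp [abs_of_pos Real.pi_pos]

/-- `beta h t` is the integral of `exp (2 π i h x)` over `[0, t]`, whose integrand has modulus 1.
Uniformity in `h` is what makes the grid argument work. -/
lemma norm_beta_sub_le (h : ℤ) (t s : ℝ) : ‖beta h t - beta h s‖ ≤ |t - s| := by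
  by_cases hh : h = 0
  · simp only [beta, hh, if_true]
    rw [← Complex.ofReal_sub, Complex.norm_real, Real.norm_eq_abs]
  · have hp : 0 < 2 * Real.pi * |(h : ℝ)| :=
      mul_pos Real.two_pi_pos (abs_pos.2 (by exact_mod_cast hh))
    have e : beta h t - beta h s = Complex.exp (2 * Real.pi * Complex.I * h * s) *
        (Complex.exp (2 * Real.pi * Complex.I * h * (t - s : ℝ)) - 1)
          / (2 * Real.pi * Complex.I * h) := by
      simp only [beta, hh, if_false]
      rw [← sub_div, mul_sub, ← Complex.exp_add]
      congr 1
      have : (2 * Real.pi * Complex.I * h * s + 2 * Real.pi * Complex.I * h * (t - s : ℝ) : ℂ)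
          = 2 * Real.pi * Complex.I * h * t := by push_cast; ring
      rw [this]; ring
    rw [e, norm_div, norm_mul, norm_exp_two_pi_I_mul, one_mul, norm_two_pi_I_mul,
      div_le_iff₀ hp, mul_comm |t - s|]
    exact norm_exp_mul_sub_one_le h (t - s)

lemma norm_beta_le {h : ℤ} (hh : h ≠ 0) (t : ℝ) : ‖beta h t‖ ≤ (Real.pi * |(h : ℝ)|)⁻¹ := by
  have hp : 0 < Real.pi * |(h : ℝ)| :=
    mul_pos Real.pi_pos (abs_pos.2 (by exact_mod_cast hh))
  simp only [beta, hh, if_false]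
  rw [norm_div, norm_two_pi_I_mul, inv_eq_one_div, div_le_div_iff₀ (by linarith) hp]
  have := norm_sub_le (Complex.exp (2 * Real.pi * Complex.I * h * t)) 1
  rw [norm_exp_two_pi_I_mul, norm_one] at this
  nlinarith

/-- At `t = 1 / 2` the exponential is `(-1) ^ h`. The result is odd in `h`, which is why
coefficients with the sign of `h` reinforce each other. -/
lemma beta_half_im (h : ℤ) :
    (beta h (1 / 2)).im = if Odd h then (Real.pi * h)⁻¹ else 0 := by
  have e : (2 * Real.pi * Complex.I * h * ((1 / 2 : ℝ) : ℂ) : ℂ)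
      = (h : ℂ) * (Real.pi * Complex.I) := by
    push_cast; ring
  by_cases hh : h = 0
  · subst hh
    simp [beta]
  · have hr : (h : ℝ) ≠ 0 := by exact_mod_cast hh
    simp only [beta, hh, if_false]
    rw [e, Complex.exp_int_mul, Complex.exp_pi_mul_I]
    split_ifs with ho
    · rw [ho.neg_one_zpow]
      have : ((-1 - 1) / (2 * Real.pi * Complex.I * h) : ℂ)
          = (((Real.pi * h)⁻¹ : ℝ) : ℂ) * Complex.I := by
        have hc : (h : ℂ) ≠ 0 := by exact_mod_cast hh
        have hpi : (Real.pi : ℂ) ≠ 0 := by exact_mod_cast Real.pi_ne_zero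
        have hI := Complex.I_ne_zero
        push_cast
        field_simp
        rw [Complex.I_sq]; norm_num
      rw [this]; simp
    · rw [(Int.not_odd_iff_even.1 ho).neg_one_zpow]; simp

/-! ### The Sato–Tate measure -/

lemma ae_satoTate_mem_Icc : ∀ᵐ x ∂satoTate, x ∈ Set.Icc (-2 : ℝ) 2 :=
  (withDensity_absolutelyContinuous _ _).ae_le (ae_restrict_mem measurableSet_Icc)

lemma integral_satoTate : ∫ x, x ∂satoTate = 0 := by
  have hm : Measurable (fun x : ℝ => ENNReal.ofReal (1 / Real.pi * Real.sqrt (1 - (x / 2) ^ 2))) := by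
    fun_prop
  unfold satoTate
  rw [integral_withDensity_eq_integral_toReal_smul hm (by simp)]
  rw [integral_Icc_eq_integral_Ioc, ← intervalIntegral.integral_of_le (by norm_num)]
  set f : ℝ → ℝ := fun x =>
    (ENNReal.ofReal (1 / Real.pi * Real.sqrt (1 - (x / 2) ^ 2))).toReal • x with hf
  have h1 : ∫ x in (-2 : ℝ)..2, f (-x) = ∫ x in (-2 : ℝ)..2, f x := by
    rw [intervalIntegral.integral_comp_neg]; simp
  have h2 : ∀ x, f (-x) = - f x := by
    intro x; simp [hf, neg_div]
  simp only [h2, intervalIntegral.integral_neg] at h1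
  change ∫ x in (-2 : ℝ)..2, f x = 0
  linarith

lemma satoTate_pos_of_Icc_subset {a b : ℝ} (hab : a < b) (ha : -2 < a) (hb : b < 2) {s : Set ℝ}
    (hs : Set.Icc a b ⊆ s) : 0 < satoTate s := by
  refine lt_of_lt_of_le ?_ (measure_mono hs)
  unfold satoTate
  have hm : Measurable (fun x : ℝ => ENNReal.ofReal (1 / Real.pi * Real.sqrt (1 - (x / 2) ^ 2))) := by
    fun_prop
  rw [withDensity_apply _ measurableSet_Icc, Measure.restrict_restrict measurableSet_Icc,
    Set.inter_eq_left.2 (Set.Icc_subset_Icc ha.le hb.le),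
    setLIntegral_pos_iff hm]
  have : Set.Icc a b ⊆ (Function.support fun x : ℝ =>
      ENNReal.ofReal (1 / Real.pi * Real.sqrt (1 - (x / 2) ^ 2))) ∩ Set.Icc a b := by
    refine Set.subset_inter (fun x hx => ?_) subset_rfl
    simp only [Function.mem_support, ne_eq, ENNReal.ofReal_eq_zero, not_le]
    refine mul_pos (by positivity) (Real.sqrt_pos.2 ?_)
    nlinarith [hx.1, hx.2]
  refine lt_of_lt_of_le ?_ (measure_mono this)
  simp [hab]

/-- `exp (-L)` bounds from below the probability of imposing the sign and size of one coefficient.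
-/
lemma exists_exp_neg_le_satoTate : ∃ L : ℝ, 0 < L ∧
    ENNReal.ofReal (Real.exp (-L)) ≤ satoTate (Set.Ici 1) ∧
    ENNReal.ofReal (Real.exp (-L)) ≤ satoTate (Set.Iic (-1)) := by
  have h1 : 0 < satoTate (Set.Ici 1) :=
    satoTate_pos_of_Icc_subset (a := 1) (b := 3 / 2) (by norm_num) (by norm_num) (by norm_num)
      fun x hx => hx.1
  have h2 : 0 < satoTate (Set.Iic (-1)) :=
    satoTate_pos_of_Icc_subset (a := -3 / 2) (b := -1) (by norm_num) (by norm_num) (by norm_num)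
      fun x hx => hx.2
  obtain ⟨r, hr0, hr⟩ := ENNReal.lt_iff_exists_nnreal_btwn.1 (lt_min h1 h2)
  have hr0' : 0 < (r : ℝ) := by exact_mod_cast hr0
  have key : ENNReal.ofReal (Real.exp (-(max 1 (-Real.log r)))) ≤ r := by
    rw [← ENNReal.ofReal_coe_nnreal]
    refine ENNReal.ofReal_le_ofReal ?_
    calc Real.exp (-(max 1 (-Real.log r))) ≤ Real.exp (Real.log r) := by
          gcongr
          linarith [le_max_right 1 (-Real.log r)]
      _ = r := Real.exp_log hr0'
  exact ⟨max 1 (-Real.log r), lt_of_lt_of_le one_pos (le_max_left _ _),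
    (key.trans hr.le).trans (min_le_left _ _), (key.trans hr.le).trans (min_le_right _ _)⟩

/-! ### Pathwise estimates: block decomposition, convergence, size at `t = 1 / 2` -/

section Deterministic

variable {Ω : Type*} {ST : ℤ → Ω → ℝ} {ω : Ω}

/-- The frequencies `h` with `16 ^ n ≤ |h| < m`. -/
noncomputable def blockIndex (n m : ℕ) : Finset ℤ :=
  Finset.Ioo (-(m : ℤ)) m \ Finset.Ioo (-((16 ^ n : ℕ) : ℤ)) ((16 ^ n : ℕ) : ℤ)

/-- The number of points of the grid on which the block starting at `16 ^ n` is controlled. -/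
def gridSize (n : ℕ) : ℕ := 128 * 32 ^ n

/-- Every block of frequencies above `16 ^ N` is small at all points of its grid. -/
def BlocksSmall (ST : ℤ → Ω → ℝ) (N : ℕ) (ω : Ω) : Prop :=
  ∀ n, N ≤ n → ∀ m ∈ Finset.Icc (16 ^ n) (16 ^ (n + 1)), ∀ j ∈ Finset.range (gridSize n + 1),
    ‖∑ h ∈ blockIndex n m, beta h ((j : ℝ) / gridSize n) * (ST h ω : ℂ)‖ ≤ (1 / 2 : ℝ) ^ n / 2

lemma BlocksSmall.mono {N N' : ℕ} (h : BlocksSmall ST N ω) (hN : N ≤ N') :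
    BlocksSmall ST N' ω :=
  fun n hn => h n (hN.trans hn)

lemma mem_blockIndex {n m : ℕ} {h : ℤ} (hh : h ∈ blockIndex n m) :
    16 ^ n ≤ h.natAbs ∧ h.natAbs < m := by
  simp only [blockIndex, Finset.mem_sdiff, Finset.mem_Ioo] at hh
  omega

lemma card_blockIndex_le (n m : ℕ) : (blockIndex n m).card ≤ 2 * m := by
  refine (Finset.card_le_card Finset.sdiff_subset).trans ?_
  rw [Int.card_Ioo]; omega

lemma partialK_sub_partialK {n m : ℕ} (hm : 16 ^ n ≤ m) (t : ℝ) :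
    partialK ST m ω t - partialK ST (16 ^ n) ω t
      = ∑ h ∈ blockIndex n m, beta h t * (ST h ω : ℂ) := by
  unfold partialK blockIndex
  rw [sub_eq_iff_eq_add, Finset.sum_sdiff]
  have : ((16 ^ n : ℕ) : ℤ) ≤ m := by exact_mod_cast hm
  exact Finset.Ioo_subset_Ioo (by omega) this

/-- Half of the bound comes from the grid point just left of `t`, half from the Lipschitz variation
between that point and `t`. -/
lemma BlocksSmall.norm_sub_le_of_mem {N n m : ℕ} (hg : BlocksSmall ST N ω)
    (hb : ∀ h, |ST h ω| ≤ 2) (hn : N ≤ n) (hm : m ∈ Finset.Icc (16 ^ n) (16 ^ (n + 1)))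
    {t : ℝ} (ht : t ∈ Set.Icc (0 : ℝ) 1) :
    ‖partialK ST m ω t - partialK ST (16 ^ n) ω t‖ ≤ (1 / 2 : ℝ) ^ n := by
  have hm' := Finset.mem_Icc.1 hm
  rw [partialK_sub_partialK hm'.1]
  have hM : (0 : ℝ) < gridSize n := by unfold gridSize; positivity
  set M : ℝ := (gridSize n : ℝ) with hMdef
  set j := ⌊t * M⌋₊ with hj
  have htM : 0 ≤ t * M := mul_nonneg ht.1 hM.le
  have hjle : j ≤ gridSize n := by
    refine Nat.floor_le_of_le ?_
    nlinarith [ht.2]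
  have h1 : (j : ℝ) ≤ t * M := Nat.floor_le htM
  have h2 : t * M < j + 1 := Nat.lt_floor_add_one _
  have hts : |t - j / M| ≤ 1 / M := by
    have : t - j / M = (t * M - j) / M := by field_simp
    rw [this, abs_div, abs_of_pos hM, abs_of_nonneg (by linarith)]
    gcongr; linarith
  have hgrid := hg n hn m hm j (by simp; omega)
  have hdiff : ‖∑ h ∈ blockIndex n m, beta h t * (ST h ω : ℂ)
      - ∑ h ∈ blockIndex n m, beta h ((j : ℝ) / M) * (ST h ω : ℂ)‖
        ≤ (1 / 2 : ℝ) ^ n / 2 := by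
    rw [← Finset.sum_sub_distrib]
    have hterm : ∀ h ∈ blockIndex n m,
        ‖beta h t * (ST h ω : ℂ) - beta h ((j : ℝ) / M) * (ST h ω : ℂ)‖ ≤ 1 / M * 2 := by
      intro h _
      rw [← sub_mul, norm_mul, Complex.norm_real, Real.norm_eq_abs]
      exact mul_le_mul ((norm_beta_sub_le h _ _).trans hts) (hb h) (abs_nonneg _) (by positivity)
    refine (norm_sum_le_of_le _ hterm).trans ?_
    rw [Finset.sum_const, nsmul_eq_mul]
    have hc : ((blockIndex n m).card : ℝ) ≤ 2 * (16 ^ (n + 1)) := by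
      have := (card_blockIndex_le n m).trans (Nat.mul_le_mul_left 2 hm'.2)
      exact_mod_cast this
    -- This fixes `gridSize`: `4 * 16 ^ (n + 1) / (128 * 32 ^ n)` is exactly half of `2 ^ (-n)`.
    calc ((blockIndex n m).card : ℝ) * (1 / M * 2) ≤ 2 * 16 ^ (n + 1) * (1 / M * 2) := by gcongr
      _ = (1 / 2 : ℝ) ^ n / 2 := by
        have e : (32 : ℝ) ^ n = 16 ^ n * 2 ^ n := by rw [← mul_pow]; norm_num
        rw [hMdef, gridSize]; push_cast
        rw [e, one_div_pow, pow_succ]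
        field_simp; norm_num
  calc _ = ‖(∑ h ∈ blockIndex n m, beta h t * (ST h ω : ℂ)
      - ∑ h ∈ blockIndex n m, beta h ((j : ℝ) / M) * (ST h ω : ℂ))
      + ∑ h ∈ blockIndex n m, beta h ((j : ℝ) / M) * (ST h ω : ℂ)‖ := by rw [sub_add_cancel]
    _ ≤ _ := norm_add_le _ _
    _ ≤ (1 / 2 : ℝ) ^ n / 2 + (1 / 2 : ℝ) ^ n / 2 := add_le_add hdiff hgrid
    _ = _ := by ring

/-- Telescoping over complete blocks. The subtracted term leaves room for one last incomplete block.
-/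
lemma BlocksSmall.norm_sub_pow_le {N : ℕ} (hg : BlocksSmall ST N ω)
    (hb : ∀ h, |ST h ω| ≤ 2) {t : ℝ} (ht : t ∈ Set.Icc (0 : ℝ) 1) {n : ℕ} (hn : N ≤ n) :
    ‖partialK ST (16 ^ n) ω t - partialK ST (16 ^ N) ω t‖
      ≤ 2 * (1 / 2 : ℝ) ^ N - 2 * (1 / 2 : ℝ) ^ n := by
  induction n, hn using Nat.le_induction with
  | base => simp
  | succ n hn ih =>
    have h1 := hg.norm_sub_le_of_mem hb hn
      (Finset.right_mem_Icc.2 (Nat.pow_le_pow_right (by norm_num) (Nat.le_succ n))) ht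
    have h2 := norm_sub_le_norm_sub_add_norm_sub (partialK ST (16 ^ (n + 1)) ω t)
      (partialK ST (16 ^ n) ω t) (partialK ST (16 ^ N) ω t)
    rw [pow_succ (1 / 2 : ℝ) n]
    linarith

lemma BlocksSmall.norm_sub_le {N : ℕ} (hg : BlocksSmall ST N ω)
    (hb : ∀ h, |ST h ω| ≤ 2) {t : ℝ} (ht : t ∈ Set.Icc (0 : ℝ) 1) {m : ℕ} (hm : 16 ^ N ≤ m) :
    ‖partialK ST m ω t - partialK ST (16 ^ N) ω t‖ ≤ 2 * (1 / 2 : ℝ) ^ N := by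
  have hm0 : m ≠ 0 := (lt_of_lt_of_le (by positivity) hm).ne'
  have hn : N ≤ Nat.log 16 m := (Nat.le_log_iff_pow_le (by norm_num) hm0).2 hm
  have h1 := hg.norm_sub_le_of_mem hb hn (m := m) (Finset.mem_Icc.2
    ⟨Nat.pow_log_le_self 16 hm0, (Nat.lt_pow_succ_log_self (by norm_num) m).le⟩) ht
  have h2 := hg.norm_sub_pow_le hb ht hn
  have h3 := norm_sub_le_norm_sub_add_norm_sub (partialK ST m ω t)
    (partialK ST (16 ^ Nat.log 16 m) ω t) (partialK ST (16 ^ N) ω t)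
  have h4 : (0 : ℝ) ≤ (1 / 2 : ℝ) ^ Nat.log 16 m := by positivity
  linarith

/-- `BlocksSmall` passes to every larger `N`, so the partial sums are Cauchy and `limUnder` is a
genuine limit. -/
lemma BlocksSmall.tendsto_limitK {N : ℕ} (hg : BlocksSmall ST N ω)
    (hb : ∀ h, |ST h ω| ≤ 2) {t : ℝ} (ht : t ∈ Set.Icc (0 : ℝ) 1) :
    Tendsto (fun m : ℕ => partialK ST m ω t) atTop (𝓝 (limitK ST ω t)) := by
  refine tendsto_nhds_limUnder (cauchySeq_tendsto_of_complete ?_)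
  refine Metric.cauchySeq_iff'.2 fun ε hε => ?_
  obtain ⟨k, hk⟩ := exists_pow_lt_of_lt_one (half_pos hε) (by norm_num : (1 / 2 : ℝ) < 1)
  refine ⟨16 ^ (N + k), fun m hm => ?_⟩
  rw [dist_eq_norm]
  refine ((hg.mono (Nat.le_add_right N k)).norm_sub_le hb ht hm).trans_lt ?_
  have : (1 / 2 : ℝ) ^ (N + k) ≤ (1 / 2 : ℝ) ^ k :=
    pow_le_pow_of_le_one (by norm_num) (by norm_num) (Nat.le_add_left k N)
  linarith

lemma BlocksSmall.norm_limitK_sub_le {N : ℕ} (hg : BlocksSmall ST N ω)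
    (hb : ∀ h, |ST h ω| ≤ 2) {t : ℝ} (ht : t ∈ Set.Icc (0 : ℝ) 1) :
    ‖limitK ST ω t - partialK ST (16 ^ N) ω t‖ ≤ 2 * (1 / 2 : ℝ) ^ N :=
  le_of_tendsto ((hg.tendsto_limitK hb ht).sub_const _).norm
    ((eventually_ge_atTop (16 ^ N)).mono fun _ hm => hg.norm_sub_le hb ht hm)

lemma continuous_beta (h : ℤ) : Continuous (beta h) :=
  (LipschitzWith.of_dist_le_mul (K := 1) fun t s => by
    simpa [dist_eq_norm] using norm_beta_sub_le h t s).continuous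

lemma continuous_partialK (m : ℕ) : Continuous (partialK ST m ω) :=
  continuous_finsetSum _ fun h _ => (continuous_beta h).mul continuous_const

lemma BlocksSmall.continuousOn_limitK {N : ℕ} (hg : BlocksSmall ST N ω)
    (hb : ∀ h, |ST h ω| ≤ 2) : ContinuousOn (limitK ST ω) (Set.Icc (0 : ℝ) 1) := by
  have hu : TendstoUniformlyOn (fun k : ℕ => partialK ST (16 ^ (N + k)) ω) (limitK ST ω) atTop
      (Set.Icc (0 : ℝ) 1) := by
    refine Metric.tendstoUniformlyOn_iff.2 fun ε hε => ?_
    obtain ⟨k, hk⟩ := exists_pow_lt_of_lt_one (half_pos hε) (by norm_num : (1 / 2 : ℝ) < 1)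
    refine (eventually_ge_atTop k).mono fun i hi t ht => ?_
    rw [dist_eq_norm]
    refine ((hg.mono (Nat.le_add_right N i)).norm_limitK_sub_le hb ht).trans_lt ?_
    have : (1 / 2 : ℝ) ^ (N + i) ≤ (1 / 2 : ℝ) ^ k :=
      pow_le_pow_of_le_one (by norm_num) (by norm_num) (by omega)
    linarith
  exact hu.continuousOn (Frequently.of_forall fun k => (continuous_partialK _).continuousOn)

lemma partialK_succ {m : ℕ} (hm : m ≠ 0) (t : ℝ) :
    partialK ST (m + 1) ω t = partialK ST m ω t
      + (beta m t * (ST m ω : ℂ) + beta (-m) t * (ST (-m) ω : ℂ)) := by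
  have : Finset.Ioo (-((m + 1 : ℕ) : ℤ)) ((m + 1 : ℕ) : ℤ)
      = insert (m : ℤ) (insert (-(m : ℤ)) (Finset.Ioo (-(m : ℤ)) m)) := by
    ext h
    simp only [Finset.mem_Ioo, Finset.mem_insert]
    omega
  unfold partialK
  rw [this, Finset.sum_insert, Finset.sum_insert]
  · ring
  · simp
  · simp; omega

lemma partialK_one (t : ℝ) : partialK ST 1 ω t = t * (ST 0 ω : ℂ) := by
  have : Finset.Ioo (-((1 : ℕ) : ℤ)) ((1 : ℕ) : ℤ) = {0} := by decide
  rw [partialK, this, Finset.sum_singleton, beta, if_pos rfl]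

lemma norm_partialK_succ_le (hb : ∀ h, |ST h ω| ≤ 2) {t : ℝ} (ht : t ∈ Set.Icc (0 : ℝ) 1) (m : ℕ) :
    ‖partialK ST (m + 1) ω t‖ ≤ 2 + 4 / Real.pi * (harmonic m : ℝ) := by
  induction m with
  | zero =>
    rw [zero_add, partialK_one, norm_mul, Complex.norm_real, Complex.norm_real, Real.norm_eq_abs,
      Real.norm_eq_abs, abs_of_nonneg ht.1]
    have := mul_le_mul ht.2 (hb 0) (abs_nonneg _) zero_le_one
    simpa using this
  | succ m ih =>
    rw [partialK_succ (Nat.succ_ne_zero m), harmonic_succ]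
    have hterm : ∀ h : ℤ, |(h : ℝ)| = m + 1 →
        ‖beta h t * (ST h ω : ℂ)‖ ≤ 2 / Real.pi * (m + 1 : ℝ)⁻¹ := by
      intro h hh
      have h0 : h ≠ 0 := by
        rintro rfl
        simp only [Int.cast_zero, abs_zero] at hh
        have : (0 : ℝ) < m + 1 := by positivity
        linarith
      rw [norm_mul, Complex.norm_real, Real.norm_eq_abs]
      refine (mul_le_mul (norm_beta_le h0 t) (hb h) (abs_nonneg _) (by positivity)).trans
        (le_of_eq ?_)
      rw [hh, mul_inv]; ring
    have h1 := hterm ((m + 1 : ℕ) : ℤ) (by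
      push_cast; exact abs_of_nonneg (by positivity))
    have h2 := hterm (-((m + 1 : ℕ) : ℤ)) (by
      push_cast; rw [abs_neg]; exact abs_of_nonneg (by positivity))
    refine (norm_add_le _ _).trans ((add_le_add ih ((norm_add_le _ _).trans
      (add_le_add h1 h2))).trans (le_of_eq ?_))
    push_cast; ring

lemma log_sixteen : Real.log 16 = 4 * Real.log 2 := by
  rw [show (16 : ℝ) = 2 ^ (4 : ℕ) by norm_num, Real.log_pow]; norm_num

lemma norm_partialK_pow_le (hb : ∀ h, |ST h ω| ≤ 2) {t : ℝ} (ht : t ∈ Set.Icc (0 : ℝ) 1) (N : ℕ) :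
    ‖partialK ST (16 ^ N) ω t‖ ≤ 4 + 4 * N := by
  have hN : 16 ^ N = (16 ^ N - 1) + 1 := (Nat.sub_add_cancel (Nat.one_le_pow _ _ (by norm_num))).symm
  have h1 := norm_partialK_succ_le hb ht (16 ^ N - 1)
  rw [← hN] at h1
  have h2 := harmonic_le_one_add_log (16 ^ N - 1)
  have h3 : Real.log ((16 ^ N - 1 : ℕ) : ℝ) ≤ N * (4 * Real.log 2) := by
    rw [← log_sixteen, ← Real.log_pow]
    have : ((16 ^ N - 1 : ℕ) : ℝ) ≤ 16 ^ N := by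
      exact_mod_cast Nat.sub_le _ _
    -- For `N = 0` the argument is 0, where `Real.log` takes the value 0.
    rcases Nat.eq_zero_or_pos (16 ^ N - 1) with h | h
    · rw [h]; simp only [Nat.cast_zero, Real.log_zero]
      exact Real.log_nonneg (one_le_pow₀ (by norm_num))
    · exact Real.log_le_log (by exact_mod_cast h) this
  have h4 := Real.log_two_lt_d9
  have h5 : 4 / Real.pi ≤ 1.28 := by
    rw [div_le_iff₀ Real.pi_pos]; linarith [Real.pi_gt_d2]
  have hN0 : (0 : ℝ) ≤ N := Nat.cast_nonneg N
  have h6 : (harmonic (16 ^ N - 1) : ℝ) ≤ 1 + 2.8 * N := by nlinarith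
  have h7 : 4 / Real.pi * (harmonic (16 ^ N - 1) : ℝ) ≤ 1.28 * (1 + 2.8 * N) :=
    (mul_le_mul_of_nonneg_left h6 (by positivity)).trans
      (mul_le_mul_of_nonneg_right h5 (by positivity))
  linarith

lemma BlocksSmall.supNorm_limitK_le {N : ℕ} (hg : BlocksSmall ST N ω)
    (hb : ∀ h, |ST h ω| ≤ 2) : supNorm (limitK ST ω) ≤ ENNReal.ofReal (6 + 4 * N) := by
  refine iSup₂_le fun t ht => ?_
  rw [← ofReal_norm]
  refine ENNReal.ofReal_le_ofReal ?_
  have h1 := hg.norm_limitK_sub_le hb ht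
  have h2 := norm_partialK_pow_le hb ht N
  have h3 := norm_sub_norm_le (limitK ST ω t) (partialK ST (16 ^ N) ω t)
  have h4 : (1 / 2 : ℝ) ^ N ≤ 1 := pow_le_one₀ (by norm_num) (by norm_num)
  linarith

/-- The coefficients `ST h` with `0 < |h| < m` all have the sign of `h` and modulus at least `1`. -/
def SignAligned (ST : ℤ → Ω → ℝ) (m : ℕ) (ω : Ω) : Prop :=
  ∀ h ∈ Finset.Ioo (-(m : ℤ)) m, (0 < h → 1 ≤ ST h ω) ∧ (h < 0 → ST h ω ≤ -1)

lemma SignAligned.mono {m m' : ℕ} (h : SignAligned ST m ω) (hm : m' ≤ m) :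
    SignAligned ST m' ω :=
  fun k hk => h k (Finset.Ioo_subset_Ioo (by omega) (by omega) hk)

/-- For odd `m`, the terms `m` and `-m` each contribute at least `1 / (π m)`, two sign changes
cancelling in the second; for even `m` both vanish. -/
lemma im_partialK_half_succ {m : ℕ} (hm : m ≠ 0) (hs : SignAligned ST (m + 1) ω) :
    (partialK ST m ω (1 / 2)).im + (if Odd m then 2 / (Real.pi * m) else 0)
      ≤ (partialK ST (m + 1) ω (1 / 2)).im := by
  rw [partialK_succ hm, Complex.add_im, Complex.add_im, Complex.im_mul_ofReal,
    Complex.im_mul_ofReal, beta_half_im, beta_half_im]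
  have h1 := (hs m (Finset.mem_Ioo.2 ⟨by omega, by omega⟩)).1 (by omega)
  have h2 := (hs (-m) (Finset.mem_Ioo.2 ⟨by omega, by omega⟩)).2 (by omega)
  have e1 : Odd (m : ℤ) ↔ Odd m := Int.odd_coe_nat m
  simp only [odd_neg, e1]
  split_ifs with ho
  · have hp : (0 : ℝ) ≤ (Real.pi * m)⁻¹ := by positivity
    push_cast
    rw [mul_neg, inv_neg, div_eq_mul_inv (2 : ℝ)]
    nlinarith
  · simp

lemma im_partialK_half_ge (k : ℕ) (hs : SignAligned ST (2 * (k + 1)) ω) :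
    (harmonic (k + 1) : ℝ) / Real.pi ≤ (partialK ST (2 * (k + 1)) ω (1 / 2)).im := by
  have hodd : ∀ k : ℕ, Odd (2 * k + 1) := fun k => ⟨k, rfl⟩
  have hstep : ∀ k : ℕ, ((k + 1 : ℝ)⁻¹) / Real.pi ≤ 2 / (Real.pi * (2 * k + 1 : ℕ)) := by
    intro k
    rw [inv_eq_one_div, div_div, div_le_div_iff₀ (by positivity) (by positivity)]
    push_cast
    nlinarith [Real.pi_pos]
  induction k with
  | zero =>
    have h1 := im_partialK_half_succ (m := 1) one_ne_zero (hs.mono (by norm_num))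
    rw [if_pos odd_one, partialK_one] at h1
    have h2 := hstep 0
    have h3 : ((((1 / 2 : ℝ)) : ℂ) * (ST 0 ω : ℂ)).im = 0 := by
      rw [← Complex.ofReal_mul, Complex.ofReal_im]
    rw [h3] at h1
    simp only [harmonic_succ, harmonic_zero]
    simp only [mul_zero, zero_add, Nat.cast_zero, Nat.cast_one, mul_one] at h1 h2 ⊢
    norm_num at h1 h2 ⊢
    linarith
  | succ k ih =>
    have h1 := ih (hs.mono (by omega))
    have h2 := im_partialK_half_succ (m := 2 * (k + 1)) (by omega) (hs.mono (by omega))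
    have h3 := im_partialK_half_succ (m := 2 * (k + 1) + 1) (by omega) (hs.mono (by omega))
    rw [if_neg (by simp)] at h2
    rw [if_pos (hodd _)] at h3
    have h4 := hstep (k + 1)
    rw [harmonic_succ, show 2 * (k + 1 + 1) = 2 * (k + 1) + 1 + 1 by ring]
    push_cast at h1 h2 h3 h4 ⊢
    rw [add_div]
    linarith

/-- The harmonic sum is at least `log (16 ^ N / 2) = (4 N - 1) log 2`, and `3 log 2 / π > 1 / 2`. -/
lemma im_partialK_pow_half_ge {N : ℕ} (hN : 1 ≤ N) (hs : SignAligned ST (16 ^ N) ω) :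
    (N : ℝ) / 2 ≤ (partialK ST (16 ^ N) ω (1 / 2)).im := by
  obtain ⟨k, hk⟩ : ∃ k, 16 ^ N = 2 * (k + 1) := by
    obtain ⟨M, rfl⟩ := Nat.exists_eq_add_of_le' hN
    refine ⟨8 * 16 ^ M - 1, ?_⟩
    have : 1 ≤ 16 ^ M := Nat.one_le_pow _ _ (by norm_num)
    rw [pow_succ]; omega
  rw [hk] at hs ⊢
  refine le_trans ?_ (im_partialK_half_ge k hs)
  rw [le_div_iff₀ Real.pi_pos]
  have h1 := log_add_one_le_harmonic (k + 1)
  have h2 : N * (4 * Real.log 2) - Real.log 2 ≤ Real.log ((k + 1 + 1 : ℕ) : ℝ) := by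
    have hk' : (16 : ℝ) ^ N = 2 * (k + 1) := by exact_mod_cast hk
    rw [← log_sixteen, ← Real.log_pow, hk', Real.log_mul (by norm_num) (by positivity)]
    have : Real.log (k + 1 : ℝ) ≤ Real.log ((k + 1 + 1 : ℕ) : ℝ) :=
      Real.log_le_log (by positivity) (by push_cast; linarith)
    linarith
  have h3 := Real.log_two_gt_d9
  have h4 := Real.pi_lt_d2
  have hN' : (1 : ℝ) ≤ N := by exact_mod_cast hN
  nlinarith

lemma BlocksSmall.le_supNorm_limitK {N : ℕ} (hg : BlocksSmall ST N ω)
    (hb : ∀ h, |ST h ω| ≤ 2) (hN : 1 ≤ N) (hs : SignAligned ST (16 ^ N) ω) :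
    ENNReal.ofReal (N / 2 - 2) ≤ supNorm (limitK ST ω) := by
  have ht : (1 / 2 : ℝ) ∈ Set.Icc (0 : ℝ) 1 := by norm_num
  refine le_trans ?_ (le_iSup₂ (f := fun t (_ : t ∈ Set.Icc (0 : ℝ) 1) => ‖limitK ST ω t‖ₑ) _ ht)
  rw [← ofReal_norm]
  refine ENNReal.ofReal_le_ofReal ?_
  have h1 := hg.norm_limitK_sub_le hb ht
  have h2 := im_partialK_pow_half_ge hN hs
  have h3 := norm_sub_norm_le (partialK ST (16 ^ N) ω (1 / 2)) (limitK ST ω (1 / 2))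
  rw [norm_sub_rev] at h3
  have h4 : (1 / 2 : ℝ) ^ N ≤ 1 := pow_le_one₀ (by norm_num) (by norm_num)
  have h5 := (le_abs_self _).trans (Complex.abs_im_le_norm (partialK ST (16 ^ N) ω (1 / 2)))
  linarith

end Deterministic

/-! ### Sub-Gaussian tails for the blocks -/

section Probability

variable {Ω : Type*} {ST : ℤ → Ω → ℝ}

section Tail

variable [MeasurableSpace Ω] {μ : Measure Ω} [IsProbabilityMeasure μ]

lemma hasSubgaussianMGF_of_hasLaw_satoTate {X : Ω → ℝ} (hX : HasLaw X satoTate μ) :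
    HasSubgaussianMGF X 4 μ := by
  have hb : ∀ᵐ ω ∂μ, X ω ∈ Set.Icc (-2 : ℝ) 2 := by
    have h := ae_satoTate_mem_Icc
    rw [← hX.map_eq] at h
    exact ae_of_ae_map hX.aemeasurable h
  have h0 : μ[X] = 0 := by
    rw [← integral_satoTate, ← hX.map_eq, integral_map hX.aemeasurable (by fun_prop)]
  have h := hasSubgaussianMGF_of_mem_Icc_of_integral_eq_zero hX.aemeasurable hb h0
  have e : (‖(2 : ℝ) - (-2)‖₊ / 2) ^ 2 = 4 := by
    rw [← NNReal.coe_inj]; push_cast; norm_num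
  rwa [e] at h

lemma measureReal_sum_ge_le (hl : ∀ h, HasLaw (ST h) satoTate μ) (hi : iIndepFun ST μ)
    (S : Finset ℤ) (a : ℤ → ℝ) {ε V : ℝ} (hε : 0 ≤ ε) (hV : 0 < V)
    (hS : ∑ h ∈ S, 4 * a h ^ 2 ≤ V) :
    μ.real {ω | ε ≤ ∑ h ∈ S, a h * ST h ω} ≤ Real.exp (-ε ^ 2 / (2 * V)) := by
  have hi' : iIndepFun (fun h ω => a h * ST h ω) μ :=
    hi.comp (fun h x => a h * x) fun h => by fun_prop
  have hsub := HasSubgaussianMGF.sum_of_iIndepFun hi' (s := S)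
    fun h _ => (hasSubgaussianMGF_of_hasLaw_satoTate (hl h)).const_mul (a h)
  have hle : ((∑ h ∈ S, (⟨a h ^ 2, sq_nonneg _⟩ * 4 : NNReal) : NNReal) : ℝ) ≤ V := by
    refine le_trans (le_of_eq ?_) hS
    push_cast
    exact Finset.sum_congr rfl fun h _ => mul_comm _ _
  -- The exact variance proxy is relaxed to the convenient upper bound `V`.
  have hmax := HasSubgaussianMGF.measure_ge_le (c := ⟨V, hV.le⟩)
    ⟨hsub.integrable_exp_mul, fun t => (hsub.mgf_le t).trans ?_⟩ hε
  · exact hmax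
  · exact Real.exp_le_exp.2 (div_le_div_of_nonneg_right
      (mul_le_mul_of_nonneg_right hle (sq_nonneg t)) zero_le_two)

lemma measureReal_abs_sum_ge_le (hl : ∀ h, HasLaw (ST h) satoTate μ) (hi : iIndepFun ST μ)
    (S : Finset ℤ) (a : ℤ → ℝ) {ε V : ℝ} (hε : 0 ≤ ε) (hV : 0 < V)
    (hS : ∑ h ∈ S, 4 * a h ^ 2 ≤ V) :
    μ.real {ω | ε ≤ |∑ h ∈ S, a h * ST h ω|} ≤ 2 * Real.exp (-ε ^ 2 / (2 * V)) := by
  have h1 := measureReal_sum_ge_le hl hi S a hε hV hS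
  have h2 := measureReal_sum_ge_le hl hi S (fun h => -a h) hε hV (by simpa using hS)
  have hsub : {ω | ε ≤ |∑ h ∈ S, a h * ST h ω|} ⊆
      {ω | ε ≤ ∑ h ∈ S, a h * ST h ω} ∪ {ω | ε ≤ ∑ h ∈ S, -a h * ST h ω} := by
    intro ω hω
    simp only [neg_mul, Finset.sum_neg_distrib, Set.mem_union, Set.mem_ofPred_eq] at hω ⊢
    exact le_abs.1 hω
  refine (measureReal_mono hsub).trans ((measureReal_union_le _ _).trans ?_)
  linarith

/-- If the modulus exceeds `r`, the real or the imaginary part has size at least `r / 2`; two signs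
for each give the factor 4. -/
lemma measureReal_norm_sum_gt_le (hl : ∀ h, HasLaw (ST h) satoTate μ) (hi : iIndepFun ST μ)
    (S : Finset ℤ) (b : ℤ → ℂ) {r V : ℝ} (hr : 0 ≤ r) (hV : 0 < V)
    (hS : ∑ h ∈ S, 4 * ‖b h‖ ^ 2 ≤ V) :
    μ.real {ω | r < ‖∑ h ∈ S, b h * (ST h ω : ℂ)‖} ≤ 4 * Real.exp (-(r / 2) ^ 2 / (2 * V)) := by
  have hre : ∑ h ∈ S, 4 * (b h).re ^ 2 ≤ V := by
    refine le_trans (Finset.sum_le_sum fun h _ => ?_) hS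
    have := pow_le_pow_left₀ (abs_nonneg _) (Complex.abs_re_le_norm (b h)) 2
    rw [sq_abs] at this; linarith
  have him : ∑ h ∈ S, 4 * (b h).im ^ 2 ≤ V := by
    refine le_trans (Finset.sum_le_sum fun h _ => ?_) hS
    have := pow_le_pow_left₀ (abs_nonneg _) (Complex.abs_im_le_norm (b h)) 2
    rw [sq_abs] at this; linarith
  have h1 := measureReal_abs_sum_ge_le hl hi S (fun h => (b h).re) (div_nonneg hr zero_le_two) hV hre
  have h2 := measureReal_abs_sum_ge_le hl hi S (fun h => (b h).im) (div_nonneg hr zero_le_two) hV him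
  have hsub : {ω | r < ‖∑ h ∈ S, b h * (ST h ω : ℂ)‖} ⊆
      {ω | r / 2 ≤ |∑ h ∈ S, (b h).re * ST h ω|} ∪
        {ω | r / 2 ≤ |∑ h ∈ S, (b h).im * ST h ω|} := by
    intro ω hω
    have h3 := lt_of_lt_of_le hω (Complex.norm_le_abs_re_add_abs_im _)
    simp only [Complex.re_sum, Complex.im_sum, Complex.re_mul_ofReal, Complex.im_mul_ofReal] at h3
    by_contra hcon
    simp only [Set.mem_union, Set.mem_ofPred_eq, not_or, not_le] at hcon
    linarith [hcon.1, hcon.2]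
  refine (measureReal_mono hsub).trans ((measureReal_union_le _ _).trans ?_)
  linarith

lemma sum_norm_beta_sq_blockIndex_le {n m : ℕ} (hm : m ≤ 16 ^ (n + 1)) (t : ℝ) :
    ∑ h ∈ blockIndex n m, 4 * ‖beta h t‖ ^ 2 ≤ 16 * (1 / 16 : ℝ) ^ n := by
  have hp : (0 : ℝ) < 16 ^ n := by positivity
  have hterm : ∀ h ∈ blockIndex n m, 4 * ‖beta h t‖ ^ 2 ≤ 4 * ((3 * 16 ^ n : ℝ)⁻¹) ^ 2 := by
    intro h hh
    have hlow := (mem_blockIndex hh).1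
    have h0 : h ≠ 0 := by
      rintro rfl
      have : 0 < 16 ^ n := by positivity
      simp at hlow
    have habs : (16 : ℝ) ^ n ≤ |(h : ℝ)| := by
      rw [← Int.cast_abs, Int.abs_eq_natAbs]
      exact_mod_cast hlow
    have : ‖beta h t‖ ≤ (3 * 16 ^ n : ℝ)⁻¹ := by
      refine (norm_beta_le h0 t).trans ?_
      have := Real.pi_gt_three
      gcongr
    gcongr
  refine (Finset.sum_le_card_nsmul _ _ _ hterm).trans ?_
  rw [nsmul_eq_mul]
  have hc : ((blockIndex n m).card : ℝ) ≤ 2 * (16 ^ (n + 1)) := by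
    have := (card_blockIndex_le n m).trans (Nat.mul_le_mul_left 2 hm)
    exact_mod_cast this
  calc ((blockIndex n m).card : ℝ) * (4 * ((3 * 16 ^ n : ℝ)⁻¹) ^ 2)
      ≤ 2 * 16 ^ (n + 1) * (4 * ((3 * 16 ^ n : ℝ)⁻¹) ^ 2) := by gcongr
    _ = 128 / 9 * (1 / 16 : ℝ) ^ n := by
      rw [one_div_pow, pow_succ]; field_simp; norm_num
    _ ≤ _ := by gcongr; norm_num

lemma measureReal_block_gt_le (hl : ∀ h, HasLaw (ST h) satoTate μ) (hi : iIndepFun ST μ)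
    {n m : ℕ} (hm : m ≤ 16 ^ (n + 1)) (t : ℝ) :
    μ.real {ω | (1 / 2 : ℝ) ^ n / 2 < ‖∑ h ∈ blockIndex n m, beta h t * (ST h ω : ℂ)‖}
      ≤ 4 * Real.exp (-((4 : ℝ) ^ n / 512)) := by
  refine (measureReal_norm_sum_gt_le hl hi (blockIndex n m) (fun h => beta h t) (by positivity)
    (by positivity) (sum_norm_beta_sq_blockIndex_le hm t)).trans (le_of_eq ?_)
  congr 2
  have e : (16 : ℝ) ^ n = 4 ^ n * 4 ^ n := by rw [← mul_pow]; norm_num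
  have e2 : (4 : ℝ) ^ n = 2 ^ n * 2 ^ n := by rw [← mul_pow]; norm_num
  rw [one_div_pow, one_div_pow, e, e2]
  field_simp
  norm_num

lemma measureReal_exists_block_gt_le (hl : ∀ h, HasLaw (ST h) satoTate μ) (hi : iIndepFun ST μ)
    (n : ℕ) :
    μ.real (⋃ m ∈ Finset.Icc (16 ^ n) (16 ^ (n + 1)), ⋃ j ∈ Finset.range (gridSize n + 1),
      {ω | (1 / 2 : ℝ) ^ n / 2 <
        ‖∑ h ∈ blockIndex n m, beta h ((j : ℝ) / gridSize n) * (ST h ω : ℂ)‖})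
      ≤ 16 ^ (n + 1) * ((gridSize n + 1) * (4 * Real.exp (-((4 : ℝ) ^ n / 512)))) := by
  refine (measureReal_biUnion_finset_le _ _).trans ?_
  have hcard : ((Finset.Icc (16 ^ n) (16 ^ (n + 1))).card : ℝ) ≤ 16 ^ (n + 1) := by
    rw [Nat.card_Icc]
    have : 16 ^ (n + 1) + 1 - 16 ^ n ≤ 16 ^ (n + 1) := by
      have : 1 ≤ 16 ^ n := Nat.one_le_pow _ _ (by norm_num)
      omega
    exact_mod_cast this
  refine (Finset.sum_le_card_nsmul _ _ ((gridSize n + 1) * (4 * Real.exp (-((4 : ℝ) ^ n / 512))))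
    fun m hm => ?_).trans ?_
  · refine (measureReal_biUnion_finset_le _ _).trans ?_
    refine (Finset.sum_le_card_nsmul _ _ (4 * Real.exp (-((4 : ℝ) ^ n / 512)))
      fun j _ => measureReal_block_gt_le hl hi (Finset.mem_Icc.1 hm).2 _).trans ?_
    simp
  · rw [nsmul_eq_mul]
    gcongr

end Tail

/-- The implied constant in the tail bound for the blocks. -/
def tailConst : ℝ := 16 * (129 * 4) * (1024 ^ 5 * 120)

lemma tailConst_pos : 0 < tailConst := by unfold tailConst; positivity

/-- Half of the exponent absorbs the union bound: `16 ^ n * 32 ^ n = 2 ^ (-n) * (4 ^ n) ^ 5`, and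
`exp` dominates a fifth power. The spare `2 ^ (-n)` makes the sum over blocks converge. -/
lemma card_mul_exp_le (n : ℕ) :
    (16 : ℝ) ^ (n + 1) * ((gridSize n + 1) * (4 * Real.exp (-((4 : ℝ) ^ n / 512))))
      ≤ tailConst * (1 / 2) ^ n * Real.exp (-((4 : ℝ) ^ n / 1024)) := by
  have h1 := Real.pow_div_factorial_le_exp ((4 : ℝ) ^ n / 1024) (by positivity) 5
  have h2 : ((4 : ℝ) ^ n) ^ 5 ≤ 1024 ^ 5 * 120 * Real.exp ((4 : ℝ) ^ n / 1024) := by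
    rw [div_pow, div_div, div_le_iff₀ (by positivity)] at h1
    refine h1.trans (le_of_eq ?_)
    norm_num [Nat.factorial]; ring
  have h3 : ((gridSize n : ℝ) + 1) ≤ 129 * 32 ^ n := by
    have : (1 : ℝ) ≤ 32 ^ n := one_le_pow₀ (by norm_num)
    unfold gridSize; push_cast; linarith
  have e : Real.exp (-((4 : ℝ) ^ n / 512))
      = Real.exp (-((4 : ℝ) ^ n / 1024)) * Real.exp (-((4 : ℝ) ^ n / 1024)) := by
    rw [← Real.exp_add]; congr 1; ring
  have e2 : (16 : ℝ) ^ n * 32 ^ n = (1 / 2) ^ n * ((4 : ℝ) ^ n) ^ 5 := by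
    rw [← pow_mul, mul_comm n 5, pow_mul, ← mul_pow, ← mul_pow]; norm_num
  have e3 : Real.exp ((4 : ℝ) ^ n / 1024) * Real.exp (-((4 : ℝ) ^ n / 1024)) = 1 := by
    rw [← Real.exp_add]; simp
  set E := Real.exp (-((4 : ℝ) ^ n / 1024)) with hE
  have hE0 : 0 < E := Real.exp_pos _
  calc (16 : ℝ) ^ (n + 1) * ((gridSize n + 1) * (4 * Real.exp (-((4 : ℝ) ^ n / 512))))
      ≤ (16 : ℝ) ^ (n + 1) * ((129 * 32 ^ n) * (4 * Real.exp (-((4 : ℝ) ^ n / 512)))) := by gcongr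
    _ = 16 * (129 * 4) * (1 / 2) ^ n * ((4 : ℝ) ^ n) ^ 5 * E * E := by
      rw [e, pow_succ]
      linear_combination (16 * (129 * 4) * E * E) * e2
    _ ≤ 16 * (129 * 4) * (1 / 2) ^ n * (1024 ^ 5 * 120 * Real.exp ((4 : ℝ) ^ n / 1024)) * E * E := by
      gcongr
    _ = tailConst * (1 / 2) ^ n * E := by
      unfold tailConst
      linear_combination (16 * (129 * 4) * (1 / 2) ^ n * (1024 ^ 5 * 120) * E) * e3

lemma measure_not_blocksSmall_le [MeasurableSpace Ω] {μ : Measure Ω} [IsProbabilityMeasure μ]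
    (hl : ∀ h, HasLaw (ST h) satoTate μ) (hi : iIndepFun ST μ) (N : ℕ) :
    μ {ω | ¬ BlocksSmall ST N ω}
      ≤ ENNReal.ofReal (2 * tailConst * Real.exp (-((4 : ℝ) ^ N / 1024))) := by
  have hsub : {ω | ¬ BlocksSmall ST N ω} ⊆ ⋃ k : ℕ,
      ⋃ m ∈ Finset.Icc (16 ^ (N + k)) (16 ^ (N + k + 1)), ⋃ j ∈ Finset.range (gridSize (N + k) + 1),
      {ω | (1 / 2 : ℝ) ^ (N + k) / 2 < ‖∑ h ∈ blockIndex (N + k) m,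
        beta h ((j : ℝ) / gridSize (N + k)) * (ST h ω : ℂ)‖} := by
    intro ω hω
    simp only [BlocksSmall, Set.mem_ofPred_eq, not_forall, not_le] at hω
    obtain ⟨n, hn, m, hm, j, hj, h⟩ := hω
    obtain ⟨k, rfl⟩ := Nat.exists_eq_add_of_le hn
    exact Set.mem_iUnion.2 ⟨k, Set.mem_iUnion₂.2 ⟨m, hm, Set.mem_iUnion₂.2 ⟨j, hj, h⟩⟩⟩
  have hC := tailConst_pos
  have hk : ∀ k : ℕ, tailConst * (1 / 2) ^ (N + k) * Real.exp (-((4 : ℝ) ^ (N + k) / 1024))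
      ≤ tailConst * Real.exp (-((4 : ℝ) ^ N / 1024)) * (1 / 2) ^ k := by
    intro k
    have h1 : (1 / 2 : ℝ) ^ (N + k) ≤ (1 / 2) ^ k :=
      pow_le_pow_of_le_one (by norm_num) (by norm_num) (Nat.le_add_left k N)
    have h2 : (4 : ℝ) ^ N ≤ 4 ^ (N + k) := pow_le_pow_right₀ (by norm_num) (Nat.le_add_right N k)
    calc _ ≤ tailConst * (1 / 2) ^ k * Real.exp (-((4 : ℝ) ^ N / 1024)) := by gcongr
      _ = _ := by ring
  calc μ {ω | ¬ BlocksSmall ST N ω} ≤ _ := measure_mono hsub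
    _ ≤ _ := measure_iUnion_le _
    _ ≤ ∑' k : ℕ, ENNReal.ofReal (tailConst * Real.exp (-((4 : ℝ) ^ N / 1024)) * (1 / 2) ^ k) := by
      refine ENNReal.tsum_le_tsum fun k => ?_
      rw [← ofReal_measureReal (measure_ne_top _ _)]
      exact ENNReal.ofReal_le_ofReal ((measureReal_exists_block_gt_le hl hi (N + k)).trans
        ((card_mul_exp_le (N + k)).trans (hk k)))
    _ = ENNReal.ofReal (∑' k : ℕ, tailConst * Real.exp (-((4 : ℝ) ^ N / 1024)) * (1 / 2) ^ k) :=
      (ENNReal.ofReal_tsum_of_nonneg (fun k => by positivity)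
        (summable_geometric_two.mul_left _)).symm
    _ = _ := by
      rw [tsum_mul_left, tsum_geometric_two]; congr 1; ring

/-! ### Measurability, sign alignment and independence -/

/-- Measurability is asked only of the high frequencies, so that the lemma applies to the σ-algebra
they generate. -/
lemma measurableSet_blocksSmall [MeasurableSpace Ω] {N : ℕ}
    (hm : ∀ h : ℤ, 16 ^ N ≤ h.natAbs → Measurable (ST h)) :
    MeasurableSet {ω | BlocksSmall ST N ω} := by
  simp only [BlocksSmall, Set.ofPred_forall]
  refine MeasurableSet.iInter fun n => MeasurableSet.iInter fun hn => MeasurableSet.iInter fun m =>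
    MeasurableSet.iInter fun _ => MeasurableSet.iInter fun j => MeasurableSet.iInter fun _ =>
      measurableSet_le (Measurable.norm (Finset.measurable_fun_sum _ fun h hh => ?_))
        measurable_const
  have := hm h ((Nat.pow_le_pow_right (by norm_num) hn).trans (mem_blockIndex hh).1)
  fun_prop

lemma measurableSet_signAligned [MeasurableSpace Ω] {m : ℕ}
    (hm : ∀ h ∈ Finset.Ioo (-(m : ℤ)) m, Measurable (ST h)) :
    MeasurableSet {ω | SignAligned ST m ω} := by
  simp only [SignAligned, Set.ofPred_forall, Set.ofPred_and]
  refine MeasurableSet.iInter fun h => MeasurableSet.iInter fun hh => MeasurableSet.inter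
    (MeasurableSet.iInter fun _ => measurableSet_le measurable_const (hm h hh))
    (MeasurableSet.iInter fun _ => measurableSet_le (hm h hh) measurable_const)

lemma measure_signAligned_ge [MeasurableSpace Ω] {μ : Measure Ω} [IsProbabilityMeasure μ]
    (hl : ∀ h, HasLaw (ST h) satoTate μ) (hi : iIndepFun ST μ) {L : ℝ} (hL : 0 < L)
    (h1 : ENNReal.ofReal (Real.exp (-L)) ≤ satoTate (Set.Ici 1))
    (h2 : ENNReal.ofReal (Real.exp (-L)) ≤ satoTate (Set.Iic (-1))) (m : ℕ) :
    ENNReal.ofReal (Real.exp (-(2 * m * L))) ≤ μ {ω | SignAligned ST m ω} := by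
  set s : ℤ → Set ℝ := fun h => if 0 < h then Set.Ici 1 else if h < 0 then Set.Iic (-1) else Set.univ
    with hs
  have hsm : ∀ h, MeasurableSet (s h) := by
    intro h; simp only [hs]; split_ifs
    exacts [measurableSet_Ici, measurableSet_Iic, MeasurableSet.univ]
  have hset : {ω | SignAligned ST m ω} = ⋂ h ∈ Finset.Ioo (-(m : ℤ)) m, ST h ⁻¹' s h := by
    ext ω
    simp only [SignAligned, Set.mem_ofPred_eq, Set.mem_iInter, Set.mem_preimage, hs]
    refine forall₂_congr fun h _ => ?_
    rcases lt_trichotomy h 0 with h0 | h0 | h0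
    · simp [h0, h0.not_gt]
    · simp [h0]
    · simp [h0, h0.not_gt]
  rw [hset, hi.measure_inter_preimage_eq_mul (Finset.Ioo (-(m : ℤ)) m) fun h _ => hsm h]
  have hterm : ∀ h ∈ Finset.Ioo (-(m : ℤ)) m,
      ENNReal.ofReal (Real.exp (-L)) ≤ μ (ST h ⁻¹' s h) := by
    intro h _
    rw [← Measure.map_apply_of_aemeasurable (hl h).aemeasurable (hsm h), (hl h).map_eq]
    simp only [hs]
    split_ifs
    · exact h1
    · exact h2
    · exact h1.trans (measure_mono (Set.subset_univ _))
  refine le_trans ?_ (Finset.prod_le_prod' hterm)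
  rw [Finset.prod_const, ← ENNReal.ofReal_pow (Real.exp_pos _).le, ← Real.exp_nat_mul]
  refine ENNReal.ofReal_le_ofReal (Real.exp_le_exp.2 ?_)
  have hc : ((Finset.Ioo (-(m : ℤ)) m).card : ℝ) ≤ 2 * m := by
    have : (Finset.Ioo (-(m : ℤ)) m).card ≤ 2 * m := by rw [Int.card_Ioo]; omega
    exact_mod_cast this
  nlinarith

/-- The two events depend on disjoint sets of frequencies, `|h| < 16 ^ N` and `|h| ≥ 16 ^ N`. -/
lemma measure_signAligned_inter_blocksSmall [MeasurableSpace Ω] {μ : Measure Ω}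
    [IsProbabilityMeasure μ] (hm : ∀ h, Measurable (ST h)) (hi : iIndepFun ST μ) (N : ℕ) :
    μ ({ω | SignAligned ST (16 ^ N) ω} ∩ {ω | BlocksSmall ST N ω})
      = μ {ω | SignAligned ST (16 ^ N) ω} * μ {ω | BlocksSmall ST N ω} := by
  set S : Set ℤ := {h | h ∈ Finset.Ioo (-((16 ^ N : ℕ) : ℤ)) ((16 ^ N : ℕ) : ℤ)} with hS
  set T : Set ℤ := {h | 16 ^ N ≤ h.natAbs} with hT
  have hST : Disjoint S T := by
    refine Set.disjoint_left.2 fun h h1 h2 => ?_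
    simp only [hS, hT, Set.mem_ofPred_eq, Finset.mem_Ioo] at h1 h2
    omega
  have hind := indep_iSup_of_disjoint (fun h => (hm h).comap_le) hi hST
  refine (Indep_iff _ _ μ).1 hind _ _ ?_ ?_
  · exact @measurableSet_signAligned Ω ST (⨆ h ∈ S, _) _ fun h hh =>
      Measurable.mono (comap_measurable (ST h))
        (le_iSup₂ (f := fun h (_ : h ∈ S) => MeasurableSpace.comap (ST h) _) h hh) le_rfl
  · exact @measurableSet_blocksSmall Ω ST (⨆ h ∈ T, _) _ fun h hh =>
      Measurable.mono (comap_measurable (ST h))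
        (le_iSup₂ (f := fun h (_ : h ∈ T) => MeasurableSpace.comap (ST h) _) h hh) le_rfl

end Probability

/-! ### From discrete scales to double exponential bounds -/

lemma exists_tail_lt {ε : ℝ} (hε : 0 < ε) :
    ∃ N0 : ℕ, ∀ N ≥ N0, 2 * tailConst * Real.exp (-((4 : ℝ) ^ N / 1024)) < ε := by
  have h1 : Tendsto (fun N : ℕ => (4 : ℝ) ^ N / 1024) atTop atTop :=
    (tendsto_pow_atTop_atTop_of_one_lt (by norm_num)).atTop_div_const (by norm_num)
  have h2 := (Real.tendsto_exp_neg_atTop_nhds_zero.comp h1).const_mul (2 * tailConst)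
  rw [mul_zero] at h2
  exact eventually_atTop.1 (h2.eventually_lt_const hε)

/-- A family of the required tail bounds at the scales `6 + 4 * N` gives a double exponential upper
bound at all scales. -/
lemma exists_doubleExp_upper {D : ℝ} (hD : 0 < D) :
    ∃ c₀ : ℝ, 0 < c₀ ∧ ∀ c ≥ c₀, ∀ A : ℝ, ∀ p ≤ (1 : ℝ),
      (∀ N : ℕ, 6 + 4 * (N : ℝ) < A → p ≤ D * Real.exp (-((4 : ℝ) ^ N / 1024))) →
      p ≤ c * Real.exp (-Real.exp (c⁻¹ * A)) := by
  have hE := Real.exp_pos (Real.exp 1)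
  refine ⟨102 + Real.exp (Real.exp 1) + D, by positivity, fun c hc A p hp h => ?_⟩
  have hc0 : 0 < c := by linarith
  -- Below 102 the size of `c` makes the bound exceed 1. Above, `N > (A - 11) / 4 ≥ A / 8 + 10`,
  -- where 10 pays for `1024 ≤ exp 10`.
  rcases lt_or_ge A 102 with hA | hA
  · have h1 : c⁻¹ * A ≤ 1 := by
      rw [inv_mul_le_iff₀ hc0]; linarith
    calc p ≤ 1 := hp
      _ = Real.exp (Real.exp 1) * Real.exp (-Real.exp 1) := by rw [← Real.exp_add]; simp
      _ ≤ c * Real.exp (-Real.exp (c⁻¹ * A)) := by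
        gcongr
        linarith
  · have hN1 : ((⌊(A - 7) / 4⌋₊ : ℕ) : ℝ) ≤ (A - 7) / 4 := Nat.floor_le (by linarith)
    have hN2 : (A - 7) / 4 < ((⌊(A - 7) / 4⌋₊ : ℕ) : ℝ) + 1 := Nat.lt_floor_add_one _
    set N := ⌊(A - 7) / 4⌋₊
    refine (h N (by linarith)).trans ?_
    have h1 : Real.exp (c⁻¹ * A) ≤ (4 : ℝ) ^ N / 1024 := by
      rw [le_div_iff₀ (by norm_num)]
      have e1 : (1024 : ℝ) ≤ Real.exp 10 := by
        have := pow_le_pow_left₀ (by norm_num) (Real.add_one_le_exp (1 : ℝ)) 10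
        rw [← Real.exp_nat_mul] at this
        norm_num at this ⊢
        exact this
      have e2 : Real.exp N ≤ (4 : ℝ) ^ N := by
        have : Real.exp (N : ℝ) = Real.exp 1 ^ N := by rw [← Real.exp_nat_mul, mul_one]
        rw [this]
        gcongr
        linarith [Real.exp_one_lt_d9]
      have e3 : c⁻¹ * A ≤ A / 8 := by
        rw [inv_mul_le_iff₀ hc0]; nlinarith
      calc Real.exp (c⁻¹ * A) * 1024 ≤ Real.exp (A / 8) * Real.exp 10 := by gcongr
        _ = Real.exp (A / 8 + 10) := (Real.exp_add _ _).symm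
        _ ≤ Real.exp N := Real.exp_le_exp.2 (by linarith)
        _ ≤ _ := e2
    gcongr
    linarith

/-- A family of lower bounds at the scales `N / 2 - 2` gives a double exponential lower bound at
all scales. -/
lemma exists_doubleExp_lower {L : ℝ} (hL : 0 < L) (N₀ : ℕ) :
    ∃ c₀ : ℝ, 0 < c₀ ∧ ∀ c ≥ c₀, ∀ A : ℝ, 0 < A → ∀ p : ℝ,
      (∀ N : ℕ, N₀ ≤ N → 1 ≤ N → A ≤ (N : ℝ) / 2 - 2 →
        1 / 2 * Real.exp (-(2 * 16 ^ N * L)) ≤ p) →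
      c⁻¹ * Real.exp (-Real.exp (c * A)) ≤ p := by
  -- With `k < 2 * A + 5` below, `2 * L + 3 * (k + N₀ + 1)` is at most `K + 6 * A`.
  set K : ℝ := 2 * L + 3 * N₀ + 18 with hK
  have hK0 : 0 < K := by positivity
  have hE := Real.exp_pos (Real.exp (K + 6))
  have hE1 : 1 ≤ Real.exp (Real.exp (K + 6)) := Real.one_le_exp (Real.exp_pos _).le
  refine ⟨K + 6 + 2 * Real.exp (Real.exp (K + 6)), by positivity, fun c hc A hA p h => ?_⟩
  have hc0 : 0 < c := by linarith
  have hN1 := Nat.le_ceil (2 * A + 4)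
  have hN2 := Nat.ceil_lt_add_one (a := 2 * A + 4) (by linarith)
  set k := ⌈2 * A + 4⌉₊
  refine le_trans ?_ (h (k + N₀ + 1) (by omega) (by omega) (by
    push_cast
    have : (0 : ℝ) ≤ N₀ := Nat.cast_nonneg _
    linarith))
  have h1 : 2 * 16 ^ (k + N₀ + 1) * L ≤ Real.exp (K + 6 * A) := by
    have e1 : (16 : ℝ) ≤ Real.exp 3 := by
      have := pow_le_pow_left₀ (by norm_num) Real.exp_one_gt_d9.le 3
      rw [← Real.exp_nat_mul] at this
      norm_num at this ⊢
      linarith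
    have e2 : (16 : ℝ) ^ (k + N₀ + 1) ≤ Real.exp (3 * (k + N₀ + 1)) := by
      have : Real.exp (3 * (k + N₀ + 1) : ℝ) = Real.exp 3 ^ (k + N₀ + 1) := by
        rw [← Real.exp_nat_mul]; push_cast; ring_nf
      rw [this]
      gcongr
    have e3 : 2 * L ≤ Real.exp (2 * L) := by linarith [Real.add_one_le_exp (2 * L)]
    calc 2 * 16 ^ (k + N₀ + 1) * L = 2 * L * 16 ^ (k + N₀ + 1) := by ring
      _ ≤ Real.exp (2 * L) * Real.exp (3 * (k + N₀ + 1)) := by gcongr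
      _ = Real.exp (2 * L + 3 * (k + N₀ + 1)) := (Real.exp_add _ _).symm
      _ ≤ Real.exp (K + 6 * A) := Real.exp_le_exp.2 (by rw [hK]; linarith)
  refine le_trans ?_ (mul_le_mul_of_nonneg_left
    (Real.exp_le_exp.2 (neg_le_neg h1)) (by norm_num : (0 : ℝ) ≤ 1 / 2))
  -- For `A ≤ 1` the prefactor `c⁻¹` suffices; for `A > 1` the constant `K` is absorbed into `c *
  -- A`.
  rcases le_or_gt A 1 with hA1 | hA1
  · have e1 : c⁻¹ ≤ (2 * Real.exp (Real.exp (K + 6)))⁻¹ := by gcongr; linarith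
    have e2 : Real.exp (-Real.exp (c * A)) ≤ 1 :=
      Real.exp_le_one_iff.2 (neg_nonpos.2 (Real.exp_pos _).le)
    calc c⁻¹ * Real.exp (-Real.exp (c * A)) ≤ (2 * Real.exp (Real.exp (K + 6)))⁻¹ * 1 := by gcongr
      _ = 1 / 2 * Real.exp (-Real.exp (K + 6)) := by rw [Real.exp_neg, mul_one, mul_inv]; ring
      _ ≤ _ := by gcongr; linarith
  · have e1 : c⁻¹ ≤ 1 / 2 := by
      rw [← inv_eq_one_div]; gcongr; linarith
    have e2 : K + 6 * A ≤ c * A := by nlinarith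
    gcongr

/-! ### Bounds for measurable, bounded coefficients -/

section Reduced

variable {Ω : Type*} [MeasurableSpace Ω] {μ : Measure Ω} [IsProbabilityMeasure μ] {ST : ℤ → Ω → ℝ}

/-- The exceptional set lies in the failure event at every `N`, whose probability tends to 0. -/
lemma ae_exists_blocksSmall (hl : ∀ h, HasLaw (ST h) satoTate μ) (hi : iIndepFun ST μ) :
    ∀ᵐ ω ∂μ, ∃ N, BlocksSmall ST N ω := by
  rw [ae_iff]
  refine le_antisymm (ENNReal.le_of_forall_pos_le_add fun ε hε _ => ?_) zero_le
  obtain ⟨N, hN⟩ := exists_tail_lt (NNReal.coe_pos.2 hε)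
  have hsub : {ω | ¬ ∃ N, BlocksSmall ST N ω} ⊆ {ω | ¬ BlocksSmall ST N ω} :=
    fun ω hω h => hω ⟨N, h⟩
  refine (measure_mono hsub).trans ((measure_not_blocksSmall_le hl hi N).trans ?_)
  rw [zero_add]
  exact ENNReal.ofReal_le_of_le_toReal (hN N le_rfl).le

lemma measureReal_le_supNorm_le (hl : ∀ h, HasLaw (ST h) satoTate μ) (hi : iIndepFun ST μ)
    (hb : ∀ h ω, |ST h ω| ≤ 2) {A : ℝ} {N : ℕ} (hN : 6 + 4 * (N : ℝ) < A) :
    μ.real {ω | ENNReal.ofReal A ≤ supNorm (limitK ST ω)}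
      ≤ 2 * tailConst * Real.exp (-((4 : ℝ) ^ N / 1024)) := by
  have hC := tailConst_pos
  refine ENNReal.toReal_le_of_le_ofReal (by positivity)
    ((measure_mono fun ω hω hg => ?_).trans (measure_not_blocksSmall_le hl hi N))
  have h1 := le_trans hω (hg.supNorm_limitK_le fun h => hb h ω)
  rw [ENNReal.ofReal_le_ofReal_iff (by positivity)] at h1
  linarith

lemma measureReal_le_supNorm_ge (hl : ∀ h, HasLaw (ST h) satoTate μ) (hi : iIndepFun ST μ)
    (hm : ∀ h, Measurable (ST h)) (hb : ∀ h ω, |ST h ω| ≤ 2) {L : ℝ} (hL : 0 < L)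
    (h1 : ENNReal.ofReal (Real.exp (-L)) ≤ satoTate (Set.Ici 1))
    (h2 : ENNReal.ofReal (Real.exp (-L)) ≤ satoTate (Set.Iic (-1))) {A : ℝ} {N : ℕ}
    (hN : 1 ≤ N) (htail : 2 * tailConst * Real.exp (-((4 : ℝ) ^ N / 1024)) < 1 / 2)
    (hA : A ≤ (N : ℝ) / 2 - 2) :
    1 / 2 * Real.exp (-(2 * 16 ^ N * L))
      ≤ μ.real {ω | ENNReal.ofReal A ≤ supNorm (limitK ST ω)} := by
  have hsub : {ω | SignAligned ST (16 ^ N) ω} ∩ {ω | BlocksSmall ST N ω} ⊆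
      {ω | ENNReal.ofReal A ≤ supNorm (limitK ST ω)} := fun ω hω =>
    (ENNReal.ofReal_le_ofReal hA).trans
      (BlocksSmall.le_supNorm_limitK hω.2 (fun h => hb h ω) hN hω.1)
  refine le_trans ?_ (measureReal_mono hsub)
  rw [measureReal_def, measure_signAligned_inter_blocksSmall hm hi N, ENNReal.toReal_mul, mul_comm]
  have hs := measure_signAligned_ge hl hi hL h1 h2 (16 ^ N)
  have hs' := (ENNReal.ofReal_le_iff_le_toReal (measure_ne_top _ _)).1 hs
  push_cast at hs'
  have hg : 1 / 2 ≤ μ.real {ω | BlocksSmall ST N ω} := by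
    have e1 := probReal_compl_eq_one_sub (μ := μ)
      (measurableSet_blocksSmall (N := N) fun h _ => hm h)
    have e2 : μ.real {ω | BlocksSmall ST N ω}ᶜ
        ≤ 2 * tailConst * Real.exp (-((4 : ℝ) ^ N / 1024)) :=
      ENNReal.toReal_le_of_le_ofReal (by have := tailConst_pos; positivity)
        (measure_not_blocksSmall_le hl hi N)
    linarith
  exact mul_le_mul hs' hg (by norm_num) ENNReal.toReal_nonneg

end Reduced

/-- Almost surely equal versions of the coefficients that are measurable and bounded by `2`. -/
lemma exists_measurable_bounded_version {Ω : Type*} [MeasurableSpace Ω] {μ : Measure Ω}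
    {ST : ℤ → Ω → ℝ} (hl : ∀ h, HasLaw (ST h) satoTate μ) :
    ∃ ST' : ℤ → Ω → ℝ, (∀ h, Measurable (ST' h)) ∧ (∀ h ω, |ST' h ω| ≤ 2) ∧
      ∀ h, ST h =ᵐ[μ] ST' h := by
  refine ⟨fun h ω => max (-2) (min 2 ((hl h).aemeasurable.mk _ ω)), fun h => ?_, fun h ω => ?_,
    fun h => ?_⟩
  -- Clipping to `[-2, 2]` gives the bound everywhere and changes values only on a null set.
  · exact measurable_const.max (measurable_const.min (hl h).aemeasurable.measurable_mk)
  · exact abs_le.2 ⟨le_max_left _ _, max_le (by norm_num) (min_le_left _ _)⟩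
  · have hb := ae_satoTate_mem_Icc
    rw [← (hl h).map_eq] at hb
    filter_upwards [ae_of_ae_map (hl h).aemeasurable hb, (hl h).aemeasurable.ae_eq_mk] with ω h1 h2
    rw [← h2, min_eq_right h1.2, max_eq_right h1.1]

end KloostermanPaths

theorem proposition4p3 :
    ∃ c : ℝ, 0 < c ∧
      ∀ (Ω : Type*) [MeasurableSpace Ω] (μ : Measure Ω) [IsProbabilityMeasure μ]
        (ST : ℤ → Ω → ℝ),
        (∀ h : ℤ, HasLaw (ST h) KloostermanPaths.satoTate μ) →
        iIndepFun ST μ →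
        -- the norm is that of a well-defined, almost surely continuous, random function
        (∀ᵐ ω ∂μ,
          (∀ t ∈ Set.Icc (0 : ℝ) 1,
            Tendsto (fun m : ℕ => KloostermanPaths.partialK ST m ω t) atTop
              (𝓝 (KloostermanPaths.limitK ST ω t))) ∧
          ContinuousOn (KloostermanPaths.limitK ST ω) (Set.Icc (0 : ℝ) 1)) ∧
        ∀ A : ℝ, 0 < A →
          c⁻¹ * Real.exp (-Real.exp (c * A)) ≤
              μ.real {ω | ENNReal.ofReal A ≤
                KloostermanPaths.supNorm (KloostermanPaths.limitK ST ω)} ∧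
            μ.real {ω | ENNReal.ofReal A ≤
                KloostermanPaths.supNorm (KloostermanPaths.limitK ST ω)} ≤
              c * Real.exp (-Real.exp (c⁻¹ * A)) := by
  open KloostermanPaths in
  obtain ⟨L, hL, hL1, hL2⟩ := exists_exp_neg_le_satoTate
  obtain ⟨N₀, hN₀⟩ := exists_tail_lt (ε := 1 / 2) (by norm_num)
  obtain ⟨c₁, hc₁, hlow⟩ := exists_doubleExp_lower hL N₀
  obtain ⟨c₂, hc₂, hup⟩ := exists_doubleExp_upper (D := 2 * tailConst)
    (mul_pos two_pos tailConst_pos)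
  refine ⟨max c₁ c₂, lt_max_of_lt_left hc₁, fun Ω _ μ _ ST hl hi => ?_⟩
  obtain ⟨ST', hm, hb, heq⟩ := exists_measurable_bounded_version hl
  have hl' : ∀ h, HasLaw (ST' h) satoTate μ := fun h => (hl h).congr (heq h).symm
  have hi' : iIndepFun ST' μ := hi.congr heq
  have hall : ∀ᵐ ω ∂μ, ∀ h, ST h ω = ST' h ω := ae_all_iff.2 heq
  have hpart : ∀ᵐ ω ∂μ, (∀ m t, partialK ST m ω t = partialK ST' m ω t) ∧
      limitK ST ω = limitK ST' ω := by
    filter_upwards [hall] with ω hω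
    have h1 : ∀ m t, partialK ST m ω t = partialK ST' m ω t := fun m t => by
      simp only [partialK, hω]
    exact ⟨h1, funext fun t => by simp only [limitK, h1]⟩
  refine ⟨?_, fun A hA => ?_⟩
  · filter_upwards [hpart, ae_exists_blocksSmall hl' hi'] with ω hω hg
    obtain ⟨N, hg⟩ := hg
    rw [hω.2]
    simp only [hω.1]
    exact ⟨fun t ht => hg.tendsto_limitK (fun h => hb h ω) ht,
      hg.continuousOn_limitK fun h => hb h ω⟩
  · have hset : μ.real {ω | ENNReal.ofReal A ≤ supNorm (limitK ST ω)}
        = μ.real {ω | ENNReal.ofReal A ≤ supNorm (limitK ST' ω)} := by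
      -- Almost everywhere equality of the events suffices; their measurability is not needed.
      refine measureReal_congr ?_
      filter_upwards [hpart] with ω hω
      exact congrArg (fun f => ENNReal.ofReal A ≤ supNorm f) hω.2
    rw [hset]
    exact ⟨hlow _ (le_max_left _ _) A hA _ fun N hN hN1 hAN =>
        measureReal_le_supNorm_ge hl' hi' hm hb hL hL1 hL2 hN1 (hN₀ N hN) hAN,
      hup _ (le_max_right _ _) A _ measureReal_le_one fun N hN =>
        measureReal_le_supNorm_le hl' hi' hb hN⟩
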